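/- Let $X=\{0,1\}^{\mathbb N}$ be the compact group of sequences $x=(x_1,x_2,\dots)$ of zeros and ones under componentwise addition modulo $2$, let $\delta_k\in X$ be the sequence whose $k$-th component is $1$ and whose other components are $0$, and let $\mu_X$ be a Haar measure on $X$. Let $Z$ be an infinite-dimensional separable complex Hilbert space with orthonormal basis $z_1,z_2,\dots$; regard it as a real Hilbert space with inner product $(z,w)=\mathrm{Re}\langle z,w\rangle$, let $\sigma:Z\to Z$ be multiplication by $i$, and let $C(Z)$ be the real Clifford algebra generated by $Z$ with the relations $zw+wz=-2(z,w)1$. The Gårding–Wightman representation $\mathbb J$ of $C(Z)$ associated to the triple $(\mu_X,1,1)$ (that is, $\nu=1$ and $c_k=1$ for all $k$) acts on the complex Hilbert space $H=L^2(X,\mu_X;\mathbb C)$; the map $z\mapsto\mathbb J_z$ is the continuous real-linear map on $Z$ with $$(\mathbb J_{z_k}f)(x)=(-1)^{x_1+\dots+x_{k-1}+1}\,i\,f(x+\delta_k),\qquad (\mathbb J_{\sigma(z_k)}f)(x)=(-1)^{x_k}\,i\,(\mathbb J_{z_k}f)(x)$$ for all $k\ge 1$, $f\in H$ and almost every $x\in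 X$. Then this representation is irreducible over $\mathbb C$ and also over $\mathbb R$: $H\neq 0$, and the only closed complex-linear subspaces of $H$, and likewise the only closed real-linear subspaces of $H$, that are invariant under $C(Z)$ are $\{0\}$ and $H$. -/

import Mathlib

open MeasureTheory Complex
open scoped ENNReal

noncomputable section

namespace GW

/-- The group `X` of sequences of occupation numbers `0`, `1`, under componentwise addition
modulo `2`, with the product topology and the `σ`-algebra generated by the coordinates. -/
abbrev X : Type := ℕ → ZMod 2

/-- The sequence whose `k`-th component is `1` and all of whose other components are `0`. -/
def δ (k : ℕ) : X := Pi.single k 1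

/-- The subgroup of sequences with only finitely many `1`'s, generated by the `δ k`. -/
def Δ : AddSubgroup X := AddSubgroup.closure (Set.range δ)

/-- The translated measure `E ↦ μ (E + d)`. -/
def translate (μ : Measure X) (d : X) : Measure X := μ.map (fun x => x - d)

/-- Parameters `(μ, 1, {c_k})` of a Gårding-Wightman module of multiplicity `ν = 1`
(so that all fibres `H_x` are `ℂ`): a measure `μ` that is quasi-invariant under `Δ`, and unitary
operators `c_k(x)` on `ℂ`, i.e. complex numbers of modulus one, that depend measurably on `x`. -/
structure Triple where
  μ : Measure X
  sigmaFinite : SigmaFinite μ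
  quasiInvariant : ∀ d ∈ Δ, translate μ d ≪ μ ∧ μ ≪ translate μ d
  c : ℕ → X → ℂ
  measurable_c : ∀ k, Measurable (c k)
  norm_c : ∀ k, ∀ᵐ x ∂μ, ‖c k x‖ = 1
  star_c : ∀ k, ∀ᵐ x ∂μ, star (c k x) = c k (x + δ k)
  comm_c : ∀ k l, ∀ᵐ x ∂μ, c k x * c l (x + δ k) = c l x * c k (x + δ l)

attribute [instance] Triple.sigmaFinite

lemma delta_mem (k : ℕ) : δ k ∈ Δ := AddSubgroup.subset_closure ⟨k, rfl⟩

lemma delta_add_self (k : ℕ) : δ k + δ k = 0 := by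
  ext i; exact CharTwo.add_self_eq_zero _

lemma measurableEmbedding_sub (d : X) : MeasurableEmbedding (fun x : X => x - d) :=
  (MeasurableEquiv.subRight d).measurableEmbedding

instance (μ : Measure X) [SigmaFinite μ] (d : X) : SigmaFinite (translate μ d) :=
  (MeasurableEquiv.subRight d).sigmaFinite_map

lemma translate_translate (μ : Measure X) (d e : X) :
    translate (translate μ e) d = translate μ (d + e) := by
  unfold translate
  rw [Measure.map_map (by fun_prop) (by fun_prop)]
  congr 1; ext x i; simp [sub_sub, add_comm]

lemma translate_zero (μ : Measure X) : translate μ 0 = μ := by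
  simp [translate]

namespace Triple

variable (T : Triple)

/-- The Hilbert space `L²(X, μ)` of the module (the direct integral of the fibres `ℂ`). -/
abbrev H : Type := Lp ℂ 2 T.μ

/-- The Radon-Nikodym derivative `dμ(x + d) / dμ(x)`. -/
def rn (d : X) : X → ℝ≥0∞ := (translate T.μ d).rnDeriv T.μ

/-- The function `x ↦ w(x) √(dμ(x + d) / dμ(x)) f(x + d)`. -/
def twistFun (w : X → ℂ) (d : X) (f : X → ℂ) : X → ℂ :=
  fun x => w x * (Real.sqrt (T.rn d x).toReal : ℂ) * f (x + d)

lemma measurable_rn (d : X) : Measurable (T.rn d) := Measure.measurable_rnDeriv _ _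

lemma rn_lt_top (d : X) : ∀ᵐ x ∂T.μ, T.rn d x < ∞ := Measure.rnDeriv_lt_top _ _

lemma quasi {d : X} (hd : d ∈ Δ) :
    Measure.QuasiMeasurePreserving (fun x => x + d) T.μ T.μ := by
  refine ⟨by fun_prop, ?_⟩
  have := (T.quasiInvariant (-d) (neg_mem hd)).1
  simpa [translate] using this

lemma rn_zero : ∀ᵐ x ∂T.μ, T.rn 0 x = 1 := by
  unfold rn
  rw [translate_zero]
  exact Measure.rnDeriv_self T.μ

lemma rn_add {d e : X} (hd : d ∈ Δ) (he : e ∈ Δ) :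
    ∀ᵐ x ∂T.μ, T.rn d x * T.rn e (x + d) = T.rn (d + e) x := by
  have h1 := (measurableEmbedding_sub d).rnDeriv_map (translate T.μ e) T.μ
  have h2 := (T.quasi hd).ae h1
  have hac : translate T.μ (d + e) ≪ translate T.μ d :=
    (T.quasiInvariant _ (add_mem hd he)).1.trans (T.quasiInvariant _ hd).2
  have h3 := Measure.rnDeriv_mul_rnDeriv (κ := T.μ) hac
  filter_upwards [h2, h3] with x hx hx'
  have e1 : Measure.map (fun x => x - d) (translate T.μ e) = translate T.μ (d + e) :=
    translate_translate T.μ d e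
  have e2 : Measure.map (fun x => x - d) T.μ = translate T.μ d := rfl
  rw [e1, e2, add_sub_cancel_right] at hx
  rw [Pi.mul_apply, hx] at hx'
  unfold rn
  rw [mul_comm]; exact hx'

lemma twistFun_congr (w : X → ℂ) {d : X} (hd : d ∈ Δ) {f g : X → ℂ} (h : f =ᵐ[T.μ] g) :
    T.twistFun w d f =ᵐ[T.μ] T.twistFun w d g := by
  filter_upwards [(T.quasi hd).ae h] with x hx
  simp [twistFun, hx]

lemma aesm_twistFun {w : X → ℂ} (hw : Measurable w) {d : X} (hd : d ∈ Δ) {f : X → ℂ}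
    (hf : AEStronglyMeasurable f T.μ) : AEStronglyMeasurable (T.twistFun w d f) T.μ := by
  have h1 := hf.comp_quasiMeasurePreserving (T.quasi hd)
  have h2 : Measurable fun x => w x * (Real.sqrt (T.rn d x).toReal : ℂ) :=
    hw.mul (measurable_ofReal.comp (T.measurable_rn d).ennreal_toReal.sqrt)
  exact h2.aestronglyMeasurable.mul h1

lemma eLpNorm_twistFun {w : X → ℂ} (hw1 : ∀ᵐ x ∂T.μ, ‖w x‖ = 1) {d : X}
    (hd : d ∈ Δ) {f : X → ℂ} (hf : AEStronglyMeasurable f T.μ) :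
    eLpNorm (T.twistFun w d f) 2 T.μ = eLpNorm f 2 T.μ := by
  rw [eLpNorm_eq_lintegral_rpow_enorm_toReal (by norm_num) (by norm_num),
    eLpNorm_eq_lintegral_rpow_enorm_toReal (by norm_num) (by norm_num)]
  congr 1
  have hac := (T.quasiInvariant d hd).1
  have hm : AEMeasurable (fun x => ‖f (x + d)‖ₑ ^ (2 : ℝ≥0∞).toReal) T.μ :=
    (hf.comp_quasiMeasurePreserving (T.quasi hd)).enorm.pow_const _
  have h := lintegral_rnDeriv_mul hac hm
  have h2 : ∫⁻ x, ‖f (x + d)‖ₑ ^ (2 : ℝ≥0∞).toReal ∂(translate T.μ d)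
      = ∫⁻ x, ‖f x‖ₑ ^ (2 : ℝ≥0∞).toReal ∂T.μ := by
    unfold translate
    rw [(measurableEmbedding_sub d).lintegral_map]
    simp
  rw [← h2, ← h]
  refine lintegral_congr_ae ?_
  filter_upwards [hw1, T.rn_lt_top d] with x hx hx'
  have h3 : ‖w x‖ₑ = 1 := by rw [← ofReal_norm, hx]; simp
  simp only [twistFun, enorm_mul, h3, one_mul]
  rw [ENNReal.mul_rpow_of_nonneg _ _ (by simp)]
  congr 1
  rw [← ofReal_norm, Complex.norm_real, Real.norm_of_nonneg (Real.sqrt_nonneg _)]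
  simp only [ENNReal.toReal_ofNat, ENNReal.rpow_ofNat]
  rw [← ENNReal.ofReal_pow (Real.sqrt_nonneg _), Real.sq_sqrt ENNReal.toReal_nonneg,
    ENNReal.ofReal_toReal hx'.ne]
  rfl

lemma memLp_twistFun {w : X → ℂ} (hw : Measurable w) (hw1 : ∀ᵐ x ∂T.μ, ‖w x‖ = 1) {d : X}
    (hd : d ∈ Δ) (f : T.H) : MemLp (T.twistFun w d f) 2 T.μ :=
  ⟨T.aesm_twistFun hw hd (Lp.aestronglyMeasurable f), by
    rw [T.eLpNorm_twistFun hw1 hd (Lp.aestronglyMeasurable f)]; exact Lp.eLpNorm_lt_top f⟩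

/-- The bounded operator `(twist f)(x) = w(x) √(dμ(x + d) / dμ(x)) f(x + d)` on `L²(X, μ)`,
for `w` measurable of modulus one and `d ∈ Δ`. -/
def twist (w : X → ℂ) (hw : Measurable w) (hw1 : ∀ᵐ x ∂T.μ, ‖w x‖ = 1) (d : X) (hd : d ∈ Δ) :
    T.H →L[ℂ] T.H :=
  LinearIsometry.toContinuousLinearMap
    { toFun := fun f => (T.memLp_twistFun hw hw1 hd f).toLp
      map_add' := by
        intro f g
        rw [← MemLp.toLp_add, MemLp.toLp_eq_toLp_iff]
        filter_upwards [(T.quasi hd).ae (Lp.coeFn_add f g)] with x hx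
        simp only [twistFun, Pi.add_apply, hx]; ring
      map_smul' := by
        intro a f
        rw [RingHom.id_apply, ← MemLp.toLp_const_smul, MemLp.toLp_eq_toLp_iff]
        filter_upwards [(T.quasi hd).ae (Lp.coeFn_smul a f)] with x hx
        simp only [twistFun, Pi.smul_apply, smul_eq_mul, hx]; ring
      norm_map' := by
        intro f
        simp only [LinearMap.coe_mk, AddHom.coe_mk]
        rw [Lp.norm_toLp, T.eLpNorm_twistFun hw1 hd (Lp.aestronglyMeasurable f), Lp.norm_def] }

lemma twist_coeFn (w : X → ℂ) (hw : Measurable w) (hw1 : ∀ᵐ x ∂T.μ, ‖w x‖ = 1) (d : X)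
    (hd : d ∈ Δ) (f : T.H) : T.twist w hw hw1 d hd f =ᵐ[T.μ] T.twistFun w d f :=
  (T.memLp_twistFun hw hw1 hd f).coeFn_toLp

lemma norm_twist (w : X → ℂ) (hw : Measurable w) (hw1 : ∀ᵐ x ∂T.μ, ‖w x‖ = 1) (d : X)
    (hd : d ∈ Δ) (f : T.H) : ‖T.twist w hw hw1 d hd f‖ = ‖f‖ := by
  rw [Lp.norm_def, Lp.norm_def, eLpNorm_congr_ae (T.twist_coeFn w hw hw1 d hd f),
    T.eLpNorm_twistFun hw1 hd (Lp.aestronglyMeasurable f)]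

lemma twist_twist (w : X → ℂ) (hw : Measurable w) (hw1 : ∀ᵐ x ∂T.μ, ‖w x‖ = 1) (d : X)
    (hd : d ∈ Δ) (v : X → ℂ) (hv : Measurable v) (hv1 : ∀ᵐ x ∂T.μ, ‖v x‖ = 1) (e : X)
    (he : e ∈ Δ) (f : T.H) :
    T.twist w hw hw1 d hd (T.twist v hv hv1 e he f) =ᵐ[T.μ]
      T.twistFun (fun x => w x * v (x + d)) (d + e) f := by
  refine (T.twist_coeFn w hw hw1 d hd _).trans
    ((T.twistFun_congr w hd (T.twist_coeFn v hv hv1 e he f)).trans ?_)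
  filter_upwards [T.rn_add hd he] with x hx
  have : Real.sqrt (T.rn (d + e) x).toReal
      = Real.sqrt (T.rn d x).toReal * Real.sqrt (T.rn e (x + d)).toReal := by
    rw [← hx, ENNReal.toReal_mul, Real.sqrt_mul ENNReal.toReal_nonneg]
  simp only [twistFun, this, ofReal_mul, add_assoc]
  ring

/-- The factor `(-1)^{x_1 + ⋯ + x_{k-1} + 1} i c_k(x)` (the indices start from `0` here). -/
def weightZ (k : ℕ) : X → ℂ :=
  fun x => (-1) ^ ((∑ j ∈ Finset.range k, (x j).val) + 1) * I * T.c k x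

/-- The factor `(-1)^{x_k} i · (-1)^{x_1 + ⋯ + x_{k-1} + 1} i c_k(x)`. -/
def weightσ (k : ℕ) : X → ℂ := fun x => (-1) ^ (x k).val * I * T.weightZ k x

lemma measurable_val (k : ℕ) : Measurable fun x : X => (x k).val :=
  (measurable_of_countable (fun a : ZMod 2 => a.val)).comp (measurable_pi_apply k)

lemma measurable_sign (g : X → ℕ) (hg : Measurable g) : Measurable fun x => (-1 : ℂ) ^ g x :=
  (measurable_of_countable (fun n : ℕ => (-1 : ℂ) ^ n)).comp hg

lemma measurable_weightZ (k : ℕ) : Measurable (T.weightZ k) := by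
  refine Measurable.mul (Measurable.mul_const (measurable_sign _ ?_) _) (T.measurable_c k)
  exact (Finset.measurable_sum _ fun j _ => measurable_val j).add_const 1

lemma measurable_weightσ (k : ℕ) : Measurable (T.weightσ k) :=
  ((measurable_sign _ (measurable_val k)).mul_const _).mul (T.measurable_weightZ k)

lemma norm_weightZ (k : ℕ) : ∀ᵐ x ∂T.μ, ‖T.weightZ k x‖ = 1 := by
  filter_upwards [T.norm_c k] with x hx
  simp [weightZ, hx]

lemma norm_weightσ (k : ℕ) : ∀ᵐ x ∂T.μ, ‖T.weightσ k x‖ = 1 := by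
  filter_upwards [T.norm_weightZ k] with x hx
  simp [weightσ, hx]

/-- The operator of the basis vector `z_k`:
`(J f)(x) = (-1)^{x_1 + ⋯ + x_{k-1} + 1} i c_k(x) √(dμ(x + δ_k) / dμ(x)) f(x + δ_k)`. -/
def opZ (k : ℕ) : T.H →L[ℂ] T.H :=
  T.twist (T.weightZ k) (T.measurable_weightZ k) (T.norm_weightZ k) (δ k) (delta_mem k)

/-- The operator of the basis vector `σ(z_k)`: `(J' f)(x) = (-1)^{x_k} i (J f)(x)`, where `J`
is the operator of `z_k`. -/
def opσ (k : ℕ) : T.H →L[ℂ] T.H :=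
  T.twist (T.weightσ k) (T.measurable_weightσ k) (T.norm_weightσ k) (δ k) (delta_mem k)

lemma opZ_apply (k : ℕ) (f : T.H) : ∀ᵐ x ∂T.μ, T.opZ k f x =
    (-1) ^ ((∑ j ∈ Finset.range k, (x j).val) + 1) * I * T.c k x *
      (Real.sqrt (((translate T.μ (δ k)).rnDeriv T.μ x).toReal) : ℂ) * f (x + δ k) :=
  T.twist_coeFn _ _ _ _ _ f

lemma opσ_apply (k : ℕ) (f : T.H) : ∀ᵐ x ∂T.μ, T.opσ k f x =
    (-1) ^ (x k).val * I * T.opZ k f x := by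
  filter_upwards [T.twist_coeFn _ (T.measurable_weightσ k) (T.norm_weightσ k) (δ k)
    (delta_mem k) f, T.twist_coeFn _ (T.measurable_weightZ k) (T.norm_weightZ k) (δ k)
    (delta_mem k) f] with x hx hx'
  rw [opσ, opZ, hx, hx']
  simp only [twistFun, weightσ]; ring

lemma sign_flip (a : ZMod 2) : (-1 : ℂ) ^ (a + 1).val = -(-1) ^ a.val := by
  have h : ∀ a : ZMod 2, (a + 1).val = 1 - a.val ∧ (a.val = 0 ∨ a.val = 1) := by decide
  obtain ⟨h1, h2 | h2⟩ := h a <;> simp [h1, h2]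

lemma sign_add_delta (x : X) (k l : ℕ) : (-1 : ℂ) ^ ((x + δ l) k).val =
    (if l = k then -1 else 1) * (-1) ^ (x k).val := by
  split_ifs with h
  · subst h
    simp [δ, sign_flip]
  · simp [δ, Pi.single_eq_of_ne (Ne.symm h)]

lemma signs_add_delta (x : X) (k l : ℕ) :
    (-1 : ℂ) ^ ((∑ j ∈ Finset.range k, ((x + δ l) j).val) + 1) =
      (if l < k then -1 else 1) * (-1) ^ ((∑ j ∈ Finset.range k, (x j).val) + 1) := by
  rw [pow_succ, pow_succ, ← Finset.prod_pow_eq_pow_sum, ← Finset.prod_pow_eq_pow_sum,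
    Finset.prod_congr rfl fun j _ => sign_add_delta x j l, Finset.prod_mul_distrib,
    Finset.prod_ite_eq]
  simp only [Finset.mem_range]; ring

lemma neg_one_pow_mul_self (n : ℕ) : ((-1 : ℂ) ^ n) * (-1) ^ n = 1 := by
  rw [← pow_add, ← two_mul, pow_mul]; simp

lemma weightZ_add_delta (k l : ℕ) (x : X) : T.weightZ k (x + δ l) =
    (if l < k then -1 else 1) * (-1) ^ ((∑ j ∈ Finset.range k, (x j).val) + 1) * I *
      T.c k (x + δ l) := by
  rw [weightZ, signs_add_delta]

lemma c_mul_c (k : ℕ) : ∀ᵐ x ∂T.μ, T.c k x * T.c k (x + δ k) = 1 := by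
  filter_upwards [T.norm_c k, T.star_c k] with x hx hx'
  rw [← hx']
  have := Complex.mul_conj (T.c k x)
  rw [Complex.normSq_eq_norm_sq, hx] at this
  simpa using this

lemma weightZ_mul_self (k : ℕ) : ∀ᵐ x ∂T.μ, T.weightZ k x * T.weightZ k (x + δ k) = -1 := by
  filter_upwards [T.c_mul_c k] with x hx
  rw [weightZ_add_delta, weightZ]
  have h := neg_one_pow_mul_self ((∑ j ∈ Finset.range k, (x j).val) + 1)
  simp only [lt_self_iff_false, if_false]
  linear_combination (I * I * T.c k x * T.c k (x + δ k)) * h + I * I * hx + Complex.I_mul_I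

lemma weightZ_mul_comm {k l : ℕ} (hkl : k ≠ l) : ∀ᵐ x ∂T.μ,
    T.weightZ k x * T.weightZ l (x + δ k) = -(T.weightZ l x * T.weightZ k (x + δ l)) := by
  filter_upwards [T.comm_c k l] with x hx
  rw [weightZ_add_delta, weightZ_add_delta, weightZ, weightZ]
  rcases lt_or_gt_of_ne hkl with h | h
  · simp only [h, h.not_gt, if_true, if_false]
    linear_combination (-(I * I) * (-1) ^ ((∑ j ∈ Finset.range k, (x j).val) + 1) *
      (-1) ^ ((∑ j ∈ Finset.range l, (x j).val) + 1)) * hx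
  · simp only [h, h.not_gt, if_true, if_false]
    linear_combination ((I * I) * (-1) ^ ((∑ j ∈ Finset.range k, (x j).val) + 1) *
      (-1) ^ ((∑ j ∈ Finset.range l, (x j).val) + 1)) * hx

/-- The operators of the real orthonormal basis `{z_k, σ(z_k)}`, as one family. -/
def op : ℕ ⊕ ℕ → T.H →L[ℂ] T.H := Sum.elim T.opZ T.opσ

lemma norm_op (i : ℕ ⊕ ℕ) (f : T.H) : ‖T.op i f‖ = ‖f‖ := by
  rcases i with k | k
  · exact T.norm_twist _ (T.measurable_weightZ k) (T.norm_weightZ k) _ (delta_mem k) f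
  · exact T.norm_twist _ (T.measurable_weightσ k) (T.norm_weightσ k) _ (delta_mem k) f

lemma weightσ_add_delta (k l : ℕ) (x : X) : T.weightσ k (x + δ l) =
    (if l = k then -1 else 1) * (-1) ^ (x k).val * I * T.weightZ k (x + δ l) := by
  rw [weightσ, sign_add_delta]

lemma twist_mul_self (w : X → ℂ) (hw : Measurable w) (hw1 : ∀ᵐ x ∂T.μ, ‖w x‖ = 1) (k : ℕ)
    (h : ∀ᵐ x ∂T.μ, w x * w (x + δ k) = -1) :
    T.twist w hw hw1 (δ k) (delta_mem k) * T.twist w hw hw1 (δ k) (delta_mem k) = -1 := by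
  ext1 f
  apply Lp.ext
  refine (T.twist_twist w hw hw1 _ (delta_mem k) w hw hw1 _ (delta_mem k) f).trans ?_
  change _ =ᵐ[T.μ] ((-f : T.H) : X → ℂ)
  filter_upwards [h, T.rn_zero, Lp.coeFn_neg f] with x hx hx' hf
  rw [twistFun, hf, delta_add_self, hx, hx']
  simp

lemma twist_mul_comm (w : X → ℂ) (hw : Measurable w) (hw1 : ∀ᵐ x ∂T.μ, ‖w x‖ = 1) (k : ℕ)
    (v : X → ℂ) (hv : Measurable v) (hv1 : ∀ᵐ x ∂T.μ, ‖v x‖ = 1) (l : ℕ)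
    (h : ∀ᵐ x ∂T.μ, w x * v (x + δ k) = -(v x * w (x + δ l))) :
    T.twist w hw hw1 (δ k) (delta_mem k) * T.twist v hv hv1 (δ l) (delta_mem l) =
      -(T.twist v hv hv1 (δ l) (delta_mem l) * T.twist w hw hw1 (δ k) (delta_mem k)) := by
  ext1 f
  apply Lp.ext
  refine (T.twist_twist w hw hw1 _ (delta_mem k) v hv hv1 _ (delta_mem l) f).trans ?_
  change _ =ᵐ[T.μ] ((-(T.twist v hv hv1 (δ l) (delta_mem l)
    (T.twist w hw hw1 (δ k) (delta_mem k) f)) : T.H) : X → ℂ)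
  filter_upwards [h, Lp.coeFn_neg (T.twist v hv hv1 (δ l) (delta_mem l)
    (T.twist w hw hw1 (δ k) (delta_mem k) f)),
    T.twist_twist v hv hv1 (δ l) (delta_mem l) w hw hw1 (δ k) (delta_mem k) f] with x hx hf hg
  rw [hf, Pi.neg_apply, hg]
  simp only [twistFun, hx, add_comm (δ l) (δ k)]; ring

lemma op_mul_self (i : ℕ ⊕ ℕ) : T.op i * T.op i = -1 := by
  rcases i with k | k
  · exact T.twist_mul_self _ (T.measurable_weightZ k) (T.norm_weightZ k) _ (T.weightZ_mul_self k)
  · refine T.twist_mul_self _ (T.measurable_weightσ k) (T.norm_weightσ k) _ ?_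
    filter_upwards [T.weightZ_mul_self k] with x hx
    rw [weightσ_add_delta, weightσ, if_pos rfl]
    linear_combination (-(I * I) * (T.weightZ k x * T.weightZ k (x + δ k))) *
      neg_one_pow_mul_self (x k).val - I * I * hx + Complex.I_mul_I

lemma op_mul_comm {i j : ℕ ⊕ ℕ} (hij : i ≠ j) : T.op i * T.op j = -(T.op j * T.op i) := by
  rcases i with k | k <;> rcases j with l | l
  · exact T.twist_mul_comm _ (T.measurable_weightZ k) (T.norm_weightZ k) _ _
      (T.measurable_weightZ l) (T.norm_weightZ l) _ (T.weightZ_mul_comm fun h => hij (h ▸ rfl))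
  · refine T.twist_mul_comm _ (T.measurable_weightZ k) (T.norm_weightZ k) _ _
      (T.measurable_weightσ l) (T.norm_weightσ l) _ ?_
    by_cases h : k = l
    · subst h
      refine Filter.Eventually.of_forall fun x => ?_
      rw [weightσ_add_delta, weightσ, if_pos rfl]; ring
    · filter_upwards [T.weightZ_mul_comm h] with x hx
      rw [weightσ_add_delta, weightσ, if_neg h]
      linear_combination ((-1) ^ (x l).val * I) * hx
  · refine T.twist_mul_comm _ (T.measurable_weightσ k) (T.norm_weightσ k) _ _
      (T.measurable_weightZ l) (T.norm_weightZ l) _ ?_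
    by_cases h : k = l
    · subst h
      refine Filter.Eventually.of_forall fun x => ?_
      rw [weightσ_add_delta, weightσ, if_pos rfl]; ring
    · filter_upwards [T.weightZ_mul_comm h] with x hx
      rw [weightσ_add_delta, weightσ, if_neg (Ne.symm h)]
      linear_combination ((-1) ^ (x k).val * I) * hx
  · have h : k ≠ l := fun h => hij (h ▸ rfl)
    refine T.twist_mul_comm _ (T.measurable_weightσ k) (T.norm_weightσ k) _ _
      (T.measurable_weightσ l) (T.norm_weightσ l) _ ?_
    filter_upwards [T.weightZ_mul_comm h] with x hx
    rw [weightσ_add_delta, weightσ_add_delta, weightσ, weightσ, if_neg h, if_neg (Ne.symm h)]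
    linear_combination ((-1) ^ (x k).val * I * (-1) ^ (x l).val * I) * hx

end Triple

section Sum

variable {H ι : Type*} [NormedAddCommGroup H] [InnerProductSpace ℂ H]
  {J : ι → H →L[ℂ] H}

lemma re_inner_eq_zero (hn : ∀ i f, ‖J i f‖ = ‖f‖) (hs : ∀ i, J i * J i = -1)
    (hc : ∀ i j, i ≠ j → J i * J j = -(J j * J i)) {i j : ι} (hij : i ≠ j) (f : H) :
    (inner ℂ (J i f) (J j f)).re = 0 := by
  have hin : ∀ i f g, inner ℂ (J i f) (J i g) = inner ℂ f g := fun i f g =>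
    (LinearIsometry.mk (J i).toLinearMap (hn i)).inner_map_map f g
  have hsk : ∀ i f g, inner ℂ (J i f) g = -inner ℂ f (J i g) := fun i f g => by
    have h : J i (J i g) = -g := congrArg (fun A : H →L[ℂ] H => A g) (hs i)
    rw [← hin i f (J i g), h, inner_neg_right, neg_neg]
  have h1 : J i (J j f) = -J j (J i f) :=
    congrArg (fun A : H →L[ℂ] H => A f) (hc i j hij)
  have h2 : inner ℂ (J i f) (J j f) = -inner ℂ (J j f) (J i f) := by
    rw [hsk i f, h1, inner_neg_right, neg_neg, hsk j f, neg_neg]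
  have h3 := congrArg Complex.re h2
  rw [Complex.neg_re, ← inner_conj_symm (J j f) (J i f), Complex.conj_re] at h3
  linarith

lemma norm_sum_sq (hn : ∀ i f, ‖J i f‖ = ‖f‖) (hs : ∀ i, J i * J i = -1)
    (hc : ∀ i j, i ≠ j → J i * J j = -(J j * J i)) (a : ι → ℝ) (s : Finset ι) (f : H) :
    ‖(∑ i ∈ s, a i • J i) f‖ ^ 2 = (∑ i ∈ s, a i ^ 2) * ‖f‖ ^ 2 := by
  classical
  induction s using Finset.induction_on with
  | empty => simp
  | insert i s hi ih =>
    rw [Finset.sum_insert hi, Finset.sum_insert hi, add_apply,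
      @norm_add_sq ℂ, ih]
    have h0 : RCLike.re (inner ℂ ((a i • J i) f) ((∑ i ∈ s, a i • J i) f)) = 0 := by
      rw [sum_apply, inner_sum, map_sum]
      refine Finset.sum_eq_zero fun j hj => ?_
      have hij : i ≠ j := fun h => hi (h ▸ hj)
      have h := re_inner_eq_zero hn hs hc hij f
      simp only [smul_apply, ← Complex.coe_smul, inner_smul_left,
        inner_smul_right, Complex.conj_ofReal, RCLike.re_to_complex, Complex.re_ofReal_mul, h,
        mul_zero]
    rw [h0, smul_apply, norm_smul, hn, mul_pow, Real.norm_eq_abs, sq_abs]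
    ring

lemma sum_mul_self (hs : ∀ i, J i * J i = -1)
    (hc : ∀ i j, i ≠ j → J i * J j = -(J j * J i)) (a : ι → ℝ) (s : Finset ι) :
    (∑ i ∈ s, a i • J i) * (∑ i ∈ s, a i • J i) = -(∑ i ∈ s, a i ^ 2) • 1 := by
  classical
  induction s using Finset.induction_on with
  | empty => simp
  | insert i s hi ih =>
    have h0 : a i • J i * ∑ j ∈ s, a j • J j = -((∑ j ∈ s, a j • J j) * a i • J i) := by
      rw [Finset.mul_sum, Finset.sum_mul, ← Finset.sum_neg_distrib]
      refine Finset.sum_congr rfl fun j hj => ?_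
      have hij : i ≠ j := fun h => hi (h ▸ hj)
      rw [smul_mul_smul_comm, smul_mul_smul_comm, hc i j hij, smul_neg, mul_comm]
    rw [Finset.sum_insert hi, Finset.sum_insert hi, mul_add, add_mul, add_mul, ih, h0,
      smul_mul_smul_comm, hs]
    module

lemma summable_smul [CompleteSpace H] (hn : ∀ i f, ‖J i f‖ = ‖f‖) (hs : ∀ i, J i * J i = -1)
    (hc : ∀ i j, i ≠ j → J i * J j = -(J j * J i)) {a : ι → ℝ}
    (ha : Summable fun i => a i ^ 2) : Summable fun i => a i • J i := by
  rw [summable_iff_vanishing_norm] at ha ⊢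
  intro ε hε
  obtain ⟨s, hs'⟩ := ha ((ε / 2) ^ 2) (by positivity)
  refine ⟨s, fun t ht => ?_⟩
  have h1 := hs' t ht
  rw [Real.norm_of_nonneg (Finset.sum_nonneg fun i _ => sq_nonneg _)] at h1
  refine lt_of_le_of_lt (ContinuousLinearMap.opNorm_le_bound _ (by positivity : 0 ≤ ε / 2)
    fun f => ?_) (half_lt_self hε)
  refine (sq_le_sq₀ (norm_nonneg _) (by positivity)).1 ?_
  rw [norm_sum_sq hn hs hc, mul_pow]
  gcongr

end Sum

section Rep

variable {Z : Type*} [NormedAddCommGroup Z] [InnerProductSpace ℂ Z]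

/-- The real quadratic form `z ↦ -(z, z)`. Its Clifford algebra is generated by `Z` with the
relations `z w + w z = -2 (z, w)`, where `(z, w)` is the real inner product. -/
def cliffordForm (Z : Type*) [NormedAddCommGroup Z] [InnerProductSpace ℂ Z] :
    QuadraticForm ℝ Z :=
  letI : InnerProductSpace ℝ Z := InnerProductSpace.complexToReal;
  -LinearMap.BilinMap.toQuadraticMap (innerₗ Z)

lemma cliffordForm_apply (z : Z) : cliffordForm Z z = -‖z‖ ^ 2 := by
  let _ : InnerProductSpace ℝ Z := InnerProductSpace.complexToReal
  simp [cliffordForm]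

/-- The coordinates of `z` in the real orthonormal basis `{z_k, σ(z_k)}`, where `z_k = b k` is
a unitary basis of `Z` and `σ` is multiplication by `i`. -/
def coord (b : HilbertBasis ℕ ℂ Z) (z : Z) : ℕ ⊕ ℕ → ℝ :=
  Sum.elim (fun k => (b.repr z k).re) (fun k => (b.repr z k).im)

lemma hasSum_coord_sq (b : HilbertBasis ℕ ℂ Z) (z : Z) :
    HasSum (fun i => coord b z i ^ 2) (‖z‖ ^ 2) := by
  have h : HasSum (fun k => ‖b.repr z k‖ ^ 2) (‖z‖ ^ 2) := by
    have := lp.hasSum_norm (p := 2) (by norm_num) (b.repr z)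
    simpa using this
  have hre : Summable fun k => (b.repr z k).re ^ 2 :=
    Summable.of_nonneg_of_le (fun _ => sq_nonneg _) (fun k => by
      rw [← Complex.normSq_eq_norm_sq, Complex.normSq_apply]
      nlinarith [sq_nonneg (b.repr z k).im]) h.summable
  have him : Summable fun k => (b.repr z k).im ^ 2 :=
    Summable.of_nonneg_of_le (fun _ => sq_nonneg _) (fun k => by
      rw [← Complex.normSq_eq_norm_sq, Complex.normSq_apply]
      nlinarith [sq_nonneg (b.repr z k).re]) h.summable
  have h2 := hre.hasSum.add him.hasSum
  have h3 : (fun k => (b.repr z k).re ^ 2 + (b.repr z k).im ^ 2) =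
      fun k => ‖b.repr z k‖ ^ 2 := by
    funext k
    rw [← Complex.normSq_eq_norm_sq, Complex.normSq_apply]; ring
  rw [h3] at h2
  rw [h.unique h2]
  exact HasSum.sum (f := fun i => coord b z i ^ 2) hre.hasSum him.hasSum

namespace Triple

variable (T : Triple) (b : HilbertBasis ℕ ℂ Z)

lemma summable_op (z : Z) : Summable fun i => coord b z i • T.op i :=
  summable_smul T.norm_op T.op_mul_self (fun _ _ h => T.op_mul_comm h)
    (hasSum_coord_sq b z).summable

/-- The real-linear map `z ↦ 𝕁_z`: the continuous real-linear extension to `Z` of the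
prescription that `z_k` and `σ(z_k)` act by `opZ k` and `opσ k`. -/
def J : Z →ₗ[ℝ] T.H →L[ℂ] T.H where
  toFun z := ∑' i, coord b z i • T.op i
  map_add' z w := by
    rw [← (T.summable_op b z).tsum_add (T.summable_op b w)]
    refine tsum_congr fun i => ?_
    rw [← add_smul]
    rcases i with k | k <;> simp [coord]
  map_smul' r z := by
    rw [RingHom.id_apply, ← (T.summable_op b z).tsum_const_smul]
    refine tsum_congr fun i => ?_
    rw [← mul_smul]
    have h : b.repr (r • z) = (r : ℂ) • b.repr z := by
      rw [← map_smul, Complex.coe_smul]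
    have hk : ∀ k, b.repr (r • z) k = (r : ℂ) * b.repr z k := fun k => by rw [h]; rfl
    rcases i with k | k <;>
      simp only [coord, Sum.elim_inl, Sum.elim_inr, hk, re_ofReal_mul, im_ofReal_mul]

lemma J_basis (k : ℕ) : T.J b (b k) = T.opZ k := by
  change ∑' i, coord b (b k) i • T.op i = T.opZ k
  rw [tsum_eq_single (Sum.inl k)]
  · simp [coord, op, b.repr_self]
  · rintro (l | l) h
    · have : l ≠ k := fun e => h (e ▸ rfl)
      simp [coord, b.repr_self, this]
    · by_cases e : l = k
      · subst e; simp [coord, b.repr_self]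
      · simp [coord, b.repr_self, e]

lemma J_I_smul_basis (k : ℕ) : T.J b (I • b k) = T.opσ k := by
  change ∑' i, coord b (I • b k) i • T.op i = T.opσ k
  rw [tsum_eq_single (Sum.inr k)]
  · simp [coord, op, b.repr_self]
  · rintro (l | l) h
    · by_cases e : l = k
      · subst e; simp [coord, b.repr_self]
      · simp [coord, b.repr_self, e]
    · have : l ≠ k := fun e => h (e ▸ rfl)
      simp [coord, b.repr_self, this]

lemma J_mul_self (z : Z) : T.J b z * T.J b z = algebraMap ℝ _ (cliffordForm Z z) := by
  have h1 : HasSum (fun i => coord b z i • T.op i) (T.J b z) := (T.summable_op b z).hasSum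
  have h2 : Filter.Tendsto (fun s : Finset (ℕ ⊕ ℕ) =>
      (∑ i ∈ s, coord b z i • T.op i) * (∑ i ∈ s, coord b z i • T.op i)) Filter.atTop
      (nhds (T.J b z * T.J b z)) := Filter.Tendsto.mul h1 h1
  have h3 : Filter.Tendsto (fun s : Finset (ℕ ⊕ ℕ) =>
      -(∑ i ∈ s, coord b z i ^ 2) • (1 : T.H →L[ℂ] T.H)) Filter.atTop
      (nhds (-(‖z‖ ^ 2) • 1)) :=
    (Filter.Tendsto.neg (hasSum_coord_sq b z)).smul_const _
  have h4 := h3.congr fun s =>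
    (sum_mul_self T.op_mul_self (fun _ _ h => T.op_mul_comm h) (coord b z) s).symm
  rw [tendsto_nhds_unique h2 h4, cliffordForm_apply, Algebra.algebraMap_eq_smul_one]

lemma norm_J_apply (z : Z) (f : T.H) : ‖T.J b z f‖ = ‖z‖ * ‖f‖ := by
  have h1 : HasSum (fun i => coord b z i • T.op i) (T.J b z) := (T.summable_op b z).hasSum
  have h2 : Filter.Tendsto (fun s : Finset (ℕ ⊕ ℕ) =>
      ‖(∑ i ∈ s, coord b z i • T.op i) f‖ ^ 2) Filter.atTop (nhds (‖T.J b z f‖ ^ 2)) :=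
    (((ContinuousLinearMap.apply ℂ T.H f).continuous.tendsto _).comp h1).norm.pow 2
  have h4 : Filter.Tendsto (fun s : Finset (ℕ ⊕ ℕ) => (∑ i ∈ s, coord b z i ^ 2) * ‖f‖ ^ 2)
      Filter.atTop (nhds (‖z‖ ^ 2 * ‖f‖ ^ 2)) :=
    Filter.Tendsto.mul_const _ (hasSum_coord_sq b z)
  have h5 := h4.congr fun s => (norm_sum_sq T.norm_op T.op_mul_self
    (fun _ _ h => T.op_mul_comm h) (coord b z) s f).symm
  have h6 := tendsto_nhds_unique h2 h5
  rw [← mul_pow] at h6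
  exact (sq_eq_sq₀ (norm_nonneg _) (by positivity)).1 h6

/-- The Gårding-Wightman representation of the real Clifford algebra `C(Z)` on `L²(X, μ)`
associated to the triple `T = (μ, 1, {c_k})` and the unitary basis `b` of `Z`. -/
def rep : CliffordAlgebra (cliffordForm Z) →ₐ[ℝ] (T.H →L[ℂ] T.H) :=
  CliffordAlgebra.lift (cliffordForm Z) ⟨T.J b, T.J_mul_self b⟩

end Triple

end Rep

/-- A representation `π` of a real algebra on a complex Hilbert space `H` is irreducible over
`𝕜` (`ℝ` or `ℂ`) if `H ≠ 0` and no closed `𝕜`-linear subspaces other than `0` and `H` are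
invariant. -/
def IrreducibleOver (𝕜 : Type*) {A H : Type*} [Ring A] [Algebra ℝ A] [NormedAddCommGroup H]
    [InnerProductSpace ℂ H] [Semiring 𝕜] [Module 𝕜 H] (π : A →ₐ[ℝ] (H →L[ℂ] H)) : Prop :=
  Nontrivial H ∧ ∀ U : Submodule 𝕜 H, IsClosed (U : Set H) →
    (∀ a : A, ∀ f ∈ U, π a f ∈ U) → U = ⊥ ∨ U = ⊤

lemma translate_haar (μ : Measure X) [μ.IsAddHaarMeasure] (d : X) : translate μ d = μ := by
  have h : (fun x : X => x - d) = fun x => x + -d := funext fun x => sub_eq_add_neg x d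
  rw [translate, h]
  exact map_add_right_eq_self μ (-d)

/-- The triple `(μ, 1, 1)` with `μ` a Haar measure on `X`. -/
def haarTriple (μ : Measure X) [μ.IsAddHaarMeasure] : Triple where
  μ := μ
  sigmaFinite := inferInstance
  quasiInvariant d _ := by
    rw [translate_haar]
    exact ⟨Measure.AbsolutelyContinuous.rfl, Measure.AbsolutelyContinuous.rfl⟩
  c _ _ := 1
  measurable_c _ := measurable_const
  norm_c _ := by simp
  star_c _ := by simp
  comm_c _ _ := by simp

end GW

end

/-!
Write `χ_k x = (-1)^{x_k}` and let `S_k` be translation by `δ_k`, with `k` counted from `0`. Since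
`𝕁_{σ(z_k)} 𝕁_{z_k}` is multiplication by `-i χ_k`, an invariant closed real subspace `U` is stable
under each `i χ_k`. Applying `i χ_j` for all `j < k` after `𝕁_{z_k}` cancels the sign in `𝕁_{z_k}`,
so `U` is stable under `i^{k+1} S_k`. Along `k = 4n` these operators are `i S_{4n}`, and
`S_{4n} → 1` strongly because `δ_{4n} → 0`; hence `i U ⊆ U`, that is, `U` is a complex subspace.

Now `U` is stable under all `χ_k` and all `S_k`, hence under multiplication by every continuous
function (Stone–Weierstrass) and under every translation. The projection to `U` commutes with
translations, so it maps the constant function `1` to a constant `a` by ergodicity. Since the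
continuous functions are dense in `L²`, the space `U` is everything if `a ≠ 0`, and its orthogonal
complement is everything if `a = 0`.
-/

noncomputable section

namespace GW

section Multiplication

variable {α 𝕜 : Type*} [TopologicalSpace α] [CompactSpace α] [MeasurableSpace α] [BorelSpace α]
  [RCLike 𝕜] (p : ℝ≥0∞) [Fact (1 ≤ p)] (μ : Measure α) [IsFiniteMeasure μ]

/-- The multiplication action of the continuous functions on `Lp`, bundled as a continuous map in
both arguments so that stability of a closed subspace passes to limits of functions. -/
def mulLp : C(α, 𝕜) →L[𝕜] Lp 𝕜 p μ →L[𝕜] Lp 𝕜 p μ :=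
  (ContinuousLinearMap.mul 𝕜 𝕜).holderL μ ∞ p p ∘L ContinuousMap.toLp ∞ μ 𝕜

variable {p μ}

lemma coeFn_mulLp (φ : C(α, 𝕜)) (f : Lp 𝕜 p μ) : mulLp p μ φ f =ᵐ[μ] fun x => φ x * f x := by
  filter_upwards [(ContinuousLinearMap.mul 𝕜 𝕜).coeFn_holder (r := p)
    (ContinuousMap.toLp ∞ μ 𝕜 φ) f, ContinuousMap.coeFn_toLp (p := ∞) (𝕜 := 𝕜) μ φ] with x hx hφ
  exact hx.trans (by rw [ContinuousLinearMap.mul_apply', hφ])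

lemma mulLp_one (f : Lp 𝕜 p μ) : mulLp p μ 1 f = f := by
  ext1
  filter_upwards [coeFn_mulLp 1 f] with x hx
  rw [hx, ContinuousMap.one_apply, one_mul]

lemma mulLp_mul (φ ψ : C(α, 𝕜)) (f : Lp 𝕜 p μ) :
    mulLp p μ (φ * ψ) f = mulLp p μ φ (mulLp p μ ψ f) := by
  ext1
  filter_upwards [coeFn_mulLp (φ * ψ) f, coeFn_mulLp φ (mulLp p μ ψ f), coeFn_mulLp ψ f]
    with x h₁ h₂ h₃
  rw [h₁, h₂, h₃, ContinuousMap.mul_apply, mul_assoc]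

lemma mulLp_const_one (φ : C(α, 𝕜)) :
    mulLp p μ φ (Lp.const p μ 1) = ContinuousMap.toLp p μ 𝕜 φ := by
  ext1
  filter_upwards [coeFn_mulLp φ (Lp.const p μ 1), Lp.coeFn_const p μ (1 : 𝕜),
    ContinuousMap.coeFn_toLp (p := p) (𝕜 := 𝕜) μ φ] with x h₁ h₂ h₃
  rw [h₁, h₂, h₃, Function.const_apply, mul_one]

lemma denseRange_mulLp_const_one [NormalSpace α] [μ.WeaklyRegular] (hp : p ≠ ∞) :
    DenseRange fun φ : C(α, 𝕜) => mulLp p μ φ (Lp.const p μ 1) := by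
  simpa only [mulLp_const_one] using ContinuousMap.toLp_denseRange 𝕜 μ 𝕜 hp

lemma inner_mulLp_left (φ : C(α, 𝕜)) (f g : Lp 𝕜 2 μ) :
    inner 𝕜 (mulLp 2 μ φ f) g = inner 𝕜 f (mulLp 2 μ (star φ) g) := by
  rw [L2.inner_def, L2.inner_def]
  refine integral_congr_ae ?_
  filter_upwards [coeFn_mulLp φ f, coeFn_mulLp (star φ) g] with x hf hg
  rw [hf, hg, ContinuousMap.star_apply, RCLike.inner_apply, RCLike.inner_apply, map_mul,
    RCLike.star_def]
  ring

lemma mulLp_mem_of_mem_adjoin {U : Submodule 𝕜 (Lp 𝕜 p μ)} {s : Set C(α, 𝕜)}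
    (hs : ∀ φ ∈ s, ∀ f ∈ U, mulLp p μ φ f ∈ U) {φ : C(α, 𝕜)} (hφ : φ ∈ Algebra.adjoin 𝕜 s) :
    ∀ f ∈ U, mulLp p μ φ f ∈ U := by
  induction hφ using Algebra.adjoin_induction with
  | mem φ hφ => exact hs φ hφ
  | algebraMap c =>
    intro f hf
    rw [Algebra.algebraMap_eq_smul_one, map_smul, smul_apply, mulLp_one]
    exact U.smul_mem c hf
  | add φ ψ _ _ hφ hψ =>
    intro f hf
    rw [map_add, add_apply]
    exact U.add_mem (hφ f hf) (hψ f hf)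
  | mul φ ψ _ _ hφ hψ =>
    intro f hf
    rw [mulLp_mul]
    exact hφ _ (hψ f hf)

lemma mulLp_mem_of_separatesPoints {U : Submodule 𝕜 (Lp 𝕜 p μ)} (hU : IsClosed (U : Set (Lp 𝕜 p μ)))
    {s : Set C(α, 𝕜)} (hstar : star s = s) (hsep : ∀ x y, x ≠ y → ∃ φ ∈ s, φ x ≠ φ y)
    (hs : ∀ φ ∈ s, ∀ f ∈ U, mulLp p μ φ f ∈ U) (φ : C(α, 𝕜)) {f : Lp 𝕜 p μ} (hf : f ∈ U) :
    mulLp p μ φ f ∈ U := by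
  have hA : (StarAlgebra.adjoin 𝕜 s).SeparatesPoints := fun x y hxy =>
    let ⟨φ, hφ, hne⟩ := hsep x y hxy
    ⟨φ, ⟨φ, StarAlgebra.subset_adjoin 𝕜 s hφ, rfl⟩, hne⟩
  have hcl : φ ∈ closure (StarAlgebra.adjoin 𝕜 s : Set C(α, 𝕜)) := by
    rw [← StarSubalgebra.topologicalClosure_coe,
      ContinuousMap.starSubalgebra_topologicalClosure_eq_top_of_separatesPoints _ hA]
    trivial
  have hcont : Continuous fun ψ => mulLp p μ ψ f :=
    (mulLp p μ).continuous.clm_apply continuous_const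
  refine closure_minimal (fun ψ hψ => ?_) (hU.preimage hcont) hcl
  rw [SetLike.mem_coe, ← StarSubalgebra.mem_toSubalgebra, StarAlgebra.adjoin_toSubalgebra, hstar,
    Set.union_self] at hψ
  exact mulLp_mem_of_mem_adjoin hs hψ f hf

end Multiplication

section Translation

variable {G α 𝕜 : Type*} [MeasurableSpace α] {μ : Measure α} [RCLike 𝕜]

open DomAddAct (mk)

lemma inner_vadd_vadd [VAdd G α] [VAddInvariantMeasure G α μ] [MeasurableConstVAdd G α]
    (c : Gᵈᵃᵃ) (f g : Lp 𝕜 2 μ) : inner 𝕜 (c +ᵥ f) (c +ᵥ g) = inner 𝕜 f g :=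
  (Lp.compMeasurePreservingₗᵢ 𝕜 _ (measurePreserving_vadd (mk.symm c) μ)).inner_map_map f g

lemma starProjection_vadd [AddGroup G] [AddAction G α] [VAddInvariantMeasure G α μ]
    [MeasurableConstVAdd G α] {U : Submodule 𝕜 (Lp 𝕜 2 μ)} [U.HasOrthogonalProjection]
    (hU : ∀ c : Gᵈᵃᵃ, ∀ f ∈ U, c +ᵥ f ∈ U) (c : Gᵈᵃᵃ) (f : Lp 𝕜 2 μ) :
    U.starProjection (c +ᵥ f) = c +ᵥ U.starProjection f := by
  refine (Submodule.eq_starProjection_of_mem_orthogonal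
    (hU c _ (U.starProjection_apply_mem f)) ?_)
  rw [← DomAddAct.vadd_Lp_sub, Submodule.mem_orthogonal]
  intro g hg
  rw [← inner_vadd_vadd (-c), neg_vadd_vadd]
  exact (U.mem_orthogonal _).1 (U.sub_starProjection_mem_orthogonal f) _ (hU _ _ hg)

lemma exists_eq_const_of_forall_vadd_eq {E : Type*} [NormedAddCommGroup E]
    [SecondCountableTopology E] {p : ℝ≥0∞} [IsFiniteMeasure μ] [VAdd G α] [ErgodicVAdd G α μ]
    [MeasurableConstVAdd G α] {f : Lp E p μ} (hf : ∀ c : Gᵈᵃᵃ, c +ᵥ f = f) :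
    ∃ a, f = Lp.const p μ a := by
  borelize E
  obtain ⟨a, ha⟩ := Filter.exists_eventuallyEq_const_of_forall_separating MeasurableSet
    (l := ae μ) (f := f) fun s hs => Filter.eventuallyConst_set.1 <|
      aeconst_of_forall_preimage_vadd_ae_eq G
        ((Lp.stronglyMeasurable f).measurable hs).nullMeasurableSet fun g => by
          have hg := DomAddAct.vadd_Lp_ae_eq (mk g) f
          rw [hf] at hg
          exact hg.symm.preimage s
  exact ⟨a, Lp.ext (ha.trans (Lp.coeFn_const p μ a).symm)⟩

section Continuity

variable {E : Type*} [NormedAddCommGroup E] [TopologicalSpace α] [R1Space α] [BorelSpace α]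
  [AddMonoid G] [TopologicalSpace G] [MeasurableSpace G] [OpensMeasurableSpace G] [AddAction G α]
  [ContinuousVAdd G α] [IsLocallyFiniteMeasure μ] [μ.InnerRegularCompactLTTop]
  [VAddInvariantMeasure G α μ] {p : ℝ≥0∞} [Fact (1 ≤ p)]

lemma continuous_mk_vadd (hp : p ≠ ∞) (f : Lp E p μ) : Continuous fun c : G => mk c +ᵥ f :=
  have : Fact (p ≠ ∞) := ⟨hp⟩
  DomAddAct.continuous_mk.vadd continuous_const

lemma mk_vadd_mem_of_dense_closure (hp : p ≠ ∞) {K : Set (Lp E p μ)} (hK : IsClosed K) {s : Set G}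
    (hs : Dense (AddSubmonoid.closure s : Set G)) (hinv : ∀ c ∈ s, ∀ f ∈ K, mk c +ᵥ f ∈ K)
    (c : G) {f : Lp E p μ} (hf : f ∈ K) : mk c +ᵥ f ∈ K := by
  refine closure_minimal (fun d hd => ?_) (hK.preimage (continuous_mk_vadd hp f)) (hs c)
  change mk d +ᵥ f ∈ K
  induction hd using AddSubmonoid.closure_induction generalizing f with
  | mem d hd => exact hinv d hd f hf
  | zero => rwa [DomAddAct.mk_zero, zero_vadd]
  | add d e _ _ hd he =>
    rw [DomAddAct.mk_add, add_vadd]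
    exact he (hd hf)

end Continuity

end Translation

section Irreducibility

variable {G α 𝕜 : Type*} [TopologicalSpace α] [CompactSpace α] [MeasurableSpace α]
  [BorelSpace α] [RCLike 𝕜] {μ : Measure α} [IsFiniteMeasure μ]
  {U : Submodule 𝕜 (Lp 𝕜 2 μ)}

lemma mulLp_mem_orthogonal (hmul : ∀ φ : C(α, 𝕜), ∀ f ∈ U, mulLp 2 μ φ f ∈ U) (φ : C(α, 𝕜)) :
    ∀ f ∈ Uᗮ, mulLp 2 μ φ f ∈ Uᗮ := by
  intro f hf g hg
  rw [← star_star φ, ← inner_mulLp_left]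
  exact hf _ (hmul _ g hg)

variable [NormalSpace α] [μ.WeaklyRegular]

lemma eq_top_of_const_mem (hU : IsClosed (U : Set (Lp 𝕜 2 μ)))
    (hmul : ∀ φ : C(α, 𝕜), ∀ f ∈ U, mulLp 2 μ φ f ∈ U) (h1 : Lp.const 2 μ 1 ∈ U) : U = ⊤ := by
  refine (Submodule.eq_top_iff').2 fun f => ?_
  exact closure_minimal (Set.range_subset_iff.2 fun φ => hmul φ _ h1) hU
    (denseRange_mulLp_const_one ENNReal.ofNat_ne_top f)

theorem eq_bot_or_eq_top_of_invariant [AddGroup G] [AddAction G α] [MeasurableConstVAdd G α]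
    [ErgodicVAdd G α μ] (hU : IsClosed (U : Set (Lp 𝕜 2 μ)))
    (hmul : ∀ φ : C(α, 𝕜), ∀ f ∈ U, mulLp 2 μ φ f ∈ U)
    (hvadd : ∀ c : Gᵈᵃᵃ, ∀ f ∈ U, c +ᵥ f ∈ U) : U = ⊥ ∨ U = ⊤ := by
  have : CompleteSpace U := hU.completeSpace_coe
  set e : Lp 𝕜 2 μ := Lp.const 2 μ 1 with he
  obtain ⟨a, ha⟩ : ∃ a : 𝕜, U.starProjection e = a • e := by
    obtain ⟨a, ha⟩ := exists_eq_const_of_forall_vadd_eq (G := G) (f := U.starProjection e)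
      fun c => by rw [← starProjection_vadd hvadd, he, DomAddAct.vadd_Lp_const]
    have hconst := (Lp.constₗ 2 μ 𝕜).map_smul a (1 : 𝕜)
    rw [smul_eq_mul, mul_one] at hconst
    exact ⟨a, ha.trans hconst⟩
  rcases eq_or_ne a 0 with rfl | ha0
  · left
    have he' : e ∈ Uᗮ := by
      rwa [zero_smul, Submodule.starProjection_apply_eq_zero_iff] at ha
    exact U.orthogonal_eq_top_iff.1
      (eq_top_of_const_mem U.isClosed_orthogonal (mulLp_mem_orthogonal hmul) he')
  · right
    refine eq_top_of_const_mem hU hmul ((U.smul_mem_iff ha0).1 ?_)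
    rw [← he, ← ha]
    exact U.starProjection_apply_mem e

end Irreducibility

lemma exists_restrictScalars_eq {H : Type*} [AddCommGroup H] [Module ℂ H] [Module ℝ H]
    [IsScalarTower ℝ ℂ H] {U : Submodule ℝ H}
    (hI : ∀ f ∈ U, I • f ∈ U) : ∃ V : Submodule ℂ H, V.restrictScalars ℝ = U := by
  refine ⟨{ U with smul_mem' := fun c f hf => ?_ }, rfl⟩
  rw [← re_add_im c, add_smul, mul_smul, ← coe_algebraMap, algebraMap_smul, algebraMap_smul]
  exact U.add_mem (U.smul_mem _ hf) (U.smul_mem _ (hI f hf))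

lemma IrreducibleOver.of_real {A H : Type*} [Ring A] [Algebra ℝ A] [NormedAddCommGroup H]
    [InnerProductSpace ℂ H] {π : A →ₐ[ℝ] (H →L[ℂ] H)} (h : IrreducibleOver ℝ π) :
    IrreducibleOver ℂ π := by
  refine ⟨h.1, fun U hU hinv => ?_⟩
  simpa only [Submodule.restrictScalars_eq_bot_iff, Submodule.restrictScalars_eq_top_iff]
    using h.2 (U.restrictScalars ℝ) hU hinv

section CoordSign

/-- The character `x ↦ (-1)^{x_k}` of `X`, as a continuous function: up to a factor `i`,
multiplication by it turns `𝕁_{z_k}` into `𝕁_{σ(z_k)}`. Together the characters separate the points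
of `X`. -/
def coordSign (k : ℕ) : C(X, ℂ) where
  toFun x := (-1) ^ (x k).val
  continuous_toFun :=
    (continuous_of_discreteTopology (f := fun a : ZMod 2 => (-1 : ℂ) ^ a.val)).comp
      (continuous_apply k)

lemma coordSign_apply (k : ℕ) (x : X) : coordSign k x = (-1) ^ (x k).val := rfl

lemma coordSign_mul_self (k : ℕ) : coordSign k * coordSign k = 1 :=
  ContinuousMap.ext fun x => Triple.neg_one_pow_mul_self (x k).val

lemma prod_coordSign_apply (k : ℕ) (x : X) :
    (∏ j ∈ Finset.range k, coordSign j) x = (-1) ^ ∑ j ∈ Finset.range k, (x j).val := by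
  simp only [ContinuousMap.prod_apply, coordSign_apply, Finset.prod_pow_eq_pow_sum]

lemma star_range_coordSign : star (Set.range coordSign) = Set.range coordSign := by
  have hstar (k : ℕ) : star (coordSign k) = coordSign k := by
    ext x
    simp [coordSign_apply]
  rw [← Set.image_star, ← Set.range_comp]
  exact congrArg Set.range (funext hstar)

lemma exists_coordSign_ne {x y : X} (hxy : x ≠ y) : ∃ φ ∈ Set.range coordSign, φ x ≠ φ y := by
  obtain ⟨k, hk⟩ := Function.ne_iff.1 hxy
  refine ⟨_, ⟨k, rfl⟩, ?_⟩
  have hval : ∀ a b : ZMod 2, a ≠ b → a.val = 0 ∧ b.val = 1 ∨ a.val = 1 ∧ b.val = 0 := by decide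
  rw [coordSign_apply, coordSign_apply]
  rcases hval _ _ hk with ⟨hx, hy⟩ | ⟨hx, hy⟩ <;> norm_num [hx, hy]

end CoordSign

section Delta

lemma tendsto_δ : Filter.Tendsto δ Filter.atTop (nhds 0) := by
  refine tendsto_pi_nhds.2 fun j => tendsto_const_nhds.congr' ?_
  filter_upwards [Filter.eventually_gt_atTop j] with k hk
  rw [δ, Pi.single_eq_of_ne hk.ne, Pi.zero_apply]

lemma dense_closure_range_δ : Dense (AddSubmonoid.closure (Set.range δ) : Set X) := by
  intro x
  refine mem_closure_of_tendsto (f := fun n => ∑ k ∈ Finset.range n, (x k).val • δ k)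
    (b := Filter.atTop) (tendsto_pi_nhds.2 fun j => tendsto_const_nhds.congr' ?_)
    (.of_forall fun n => sum_mem fun k _ =>
      nsmul_mem (AddSubmonoid.subset_closure (Set.mem_range_self k)) _)
  filter_upwards [Filter.eventually_gt_atTop j] with n hn
  simp [δ, Finset.sum_apply, Pi.single_apply, hn, -ZMod.natCast_val, ZMod.natCast_zmod_val]

end Delta

section Operators

variable {T : Triple} [IsFiniteMeasure T.μ]

lemma opσ_opZ (k : ℕ) (f : T.H) : T.opσ k (T.opZ k f) = -I • mulLp 2 T.μ (coordSign k) f := by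
  have hsq : T.opZ k (T.opZ k f) = -f := congrArg (fun A => A f) (T.op_mul_self (.inl k))
  ext1
  filter_upwards [T.opσ_apply k (T.opZ k f), Lp.coeFn_smul (-I) (mulLp 2 T.μ (coordSign k) f),
    coeFn_mulLp (coordSign k) f, Lp.coeFn_neg f] with x hx hsmul hmul hneg
  rw [hx, hsq, hneg, hsmul, Pi.smul_apply, hmul, coordSign_apply, Pi.neg_apply, smul_eq_mul]
  ring

variable {U : Submodule ℝ T.H}

lemma I_smul_mulLp_coordSign_mem (hZ : ∀ k, ∀ f ∈ U, T.opZ k f ∈ U)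
    (hσ : ∀ k, ∀ f ∈ U, T.opσ k f ∈ U) (k : ℕ) {f : T.H} (hf : f ∈ U) :
    I • mulLp 2 T.μ (coordSign k) f ∈ U := by
  rw [← neg_mem_iff, ← neg_smul, ← opσ_opZ]
  exact hσ k _ (hZ k f hf)

lemma I_pow_smul_mulLp_prod_coordSign_mem (hZ : ∀ k, ∀ f ∈ U, T.opZ k f ∈ U)
    (hσ : ∀ k, ∀ f ∈ U, T.opσ k f ∈ U) (k : ℕ) :
    ∀ f ∈ U, I ^ k • mulLp 2 T.μ (∏ j ∈ Finset.range k, coordSign j) f ∈ U := by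
  induction k with
  | zero =>
    intro f hf
    rwa [pow_zero, one_smul, Finset.prod_range_zero, mulLp_one]
  | succ k ih =>
    intro f hf
    rw [Finset.prod_range_succ, mulLp_mul, pow_succ, mul_smul, ← map_smul]
    exact ih _ (I_smul_mulLp_coordSign_mem hZ hσ k hf)

end Operators

section HaarMeasure

variable {T : Triple} [T.μ.IsAddHaarMeasure]

lemma opZ_eq_of_forall_c_eq_one (hc : ∀ k x, T.c k x = 1) (k : ℕ) (f : T.H) :
    T.opZ k f =
      -I • mulLp 2 T.μ (∏ j ∈ Finset.range k, coordSign j) (DomAddAct.mk (δ k) +ᵥ f) := by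
  have hrn : (translate T.μ (δ k)).rnDeriv T.μ =ᵐ[T.μ] fun _ => 1 := by
    rw [translate_haar]
    exact T.μ.rnDeriv_self
  ext1
  filter_upwards [T.opZ_apply k f, hrn, Lp.coeFn_smul (-I)
    (mulLp 2 T.μ (∏ j ∈ Finset.range k, coordSign j) (DomAddAct.mk (δ k) +ᵥ f)),
    coeFn_mulLp (∏ j ∈ Finset.range k, coordSign j) (DomAddAct.mk (δ k) +ᵥ f),
    DomAddAct.vadd_Lp_ae_eq (DomAddAct.mk (δ k)) f] with x hx hrn hsmul hmul hvadd
  rw [hx, hrn, hsmul, Pi.smul_apply, hmul, prod_coordSign_apply, hvadd, Equiv.symm_apply_apply,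
    vadd_eq_add, add_comm x, hc, ENNReal.toReal_one, Real.sqrt_one, ofReal_one, smul_eq_mul]
  ring

lemma I_pow_smul_mk_vadd_mem (hc : ∀ k x, T.c k x = 1) {U : Submodule ℝ T.H}
    (hZ : ∀ k, ∀ f ∈ U, T.opZ k f ∈ U) (hσ : ∀ k, ∀ f ∈ U, T.opσ k f ∈ U) (k : ℕ) {f : T.H}
    (hf : f ∈ U) : I ^ (k + 1) • (DomAddAct.mk (δ k) +ᵥ f) ∈ U := by
  have h := I_pow_smul_mulLp_prod_coordSign_mem hZ hσ k _ (hZ k f hf)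
  rw [opZ_eq_of_forall_c_eq_one hc, map_smul, ← mulLp_mul, ← Finset.prod_mul_distrib,
    Finset.prod_congr rfl fun j _ => coordSign_mul_self j, Finset.prod_const_one, mulLp_one,
    smul_smul, mul_neg, ← pow_succ, neg_smul] at h
  exact neg_mem_iff.1 h

lemma I_smul_mem (hc : ∀ k x, T.c k x = 1) {U : Submodule ℝ T.H} (hU : IsClosed (U : Set T.H))
    (hZ : ∀ k, ∀ f ∈ U, T.opZ k f ∈ U) (hσ : ∀ k, ∀ f ∈ U, T.opσ k f ∈ U) {f : T.H}
    (hf : f ∈ U) : I • f ∈ U := by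
  have hδ : Filter.Tendsto (fun n => δ (4 * n)) Filter.atTop (nhds 0) :=
    tendsto_δ.comp (Filter.tendsto_id.const_mul_atTop' (by norm_num))
  have hlim : Filter.Tendsto (fun n => I • (DomAddAct.mk (δ (4 * n)) +ᵥ f)) Filter.atTop
      (nhds (I • f)) := by
    simpa only [DomAddAct.mk_zero, zero_vadd, Function.comp_apply] using
      (((continuous_mk_vadd ENNReal.ofNat_ne_top f).tendsto 0).comp hδ).const_smul I
  refine hU.mem_of_tendsto hlim (.of_forall fun n => ?_)
  have h := I_pow_smul_mk_vadd_mem hc hZ hσ (4 * n) hf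
  rwa [pow_succ, pow_mul, I_pow_four, one_pow, one_mul] at h

lemma eq_bot_or_eq_top_of_coordSign_of_δ {U : Submodule ℂ T.H} (hU : IsClosed (U : Set T.H))
    (hmul : ∀ k, ∀ f ∈ U, mulLp 2 T.μ (coordSign k) f ∈ U)
    (hvadd : ∀ k, ∀ f ∈ U, DomAddAct.mk (δ k) +ᵥ f ∈ U) : U = ⊥ ∨ U = ⊤ := by
  refine eq_bot_or_eq_top_of_invariant (G := X) hU (fun φ f => ?_) fun c f => ?_
  · exact mulLp_mem_of_separatesPoints hU star_range_coordSign (fun _ _ => exists_coordSign_ne)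
      (Set.forall_mem_range.2 hmul) φ
  · exact mk_vadd_mem_of_dense_closure ENNReal.ofNat_ne_top hU dense_closure_range_δ
      (Set.forall_mem_range.2 hvadd) (DomAddAct.mk.symm c)

theorem irreducibleOver_real (hc : ∀ k x, T.c k x = 1) {Z : Type*} [NormedAddCommGroup Z]
    [InnerProductSpace ℂ Z] (b : HilbertBasis ℕ ℂ Z) : IrreducibleOver ℝ (T.rep b) := by
  have h1 : (Lp.const 2 T.μ 1 : T.H) ≠ 0 := by
    rw [← norm_ne_zero_iff, Lp.norm_const 2 T.μ 1 two_ne_zero, norm_one, one_mul]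
    exact (Real.rpow_pos_of_pos measureReal_univ_pos _).ne'
  refine ⟨⟨_, _, h1⟩, fun U hU hinv => ?_⟩
  have hJ (z : Z) (f : T.H) (hf : f ∈ U) : T.J b z f ∈ U := by
    have hι : T.rep b (CliffordAlgebra.ι _ z) = T.J b z := CliffordAlgebra.lift_ι_apply _ _ _
    exact hι ▸ hinv (CliffordAlgebra.ι _ z) f hf
  have hZ (k : ℕ) (f : T.H) (hf : f ∈ U) : T.opZ k f ∈ U := T.J_basis b k ▸ hJ _ f hf
  have hσ (k : ℕ) (f : T.H) (hf : f ∈ U) : T.opσ k f ∈ U := T.J_I_smul_basis b k ▸ hJ _ f hf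
  obtain ⟨V, rfl⟩ := exists_restrictScalars_eq fun f => I_smul_mem hc hU hZ hσ (f := f)
  rw [Submodule.restrictScalars_eq_bot_iff, Submodule.restrictScalars_eq_top_iff]
  refine eq_bot_or_eq_top_of_coordSign_of_δ hU (fun k f hf => ?_) fun k f hf => ?_
  · exact (V.smul_mem_iff I_ne_zero).1 (I_smul_mulLp_coordSign_mem hZ hσ k hf)
  · exact (V.smul_mem_iff (pow_ne_zero _ I_ne_zero)).1 (I_pow_smul_mk_vadd_mem hc hZ hσ k hf)

end HaarMeasure

end GW

end

theorem corollary3p8 {Z : Type*} [NormedAddCommGroup Z] [InnerProductSpace ℂ Z]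
    (b : HilbertBasis ℕ ℂ Z) (μ : MeasureTheory.Measure GW.X) [μ.IsAddHaarMeasure] :
    GW.IrreducibleOver ℂ ((GW.haarTriple μ).rep b) ∧
      GW.IrreducibleOver ℝ ((GW.haarTriple μ).rep b) := by
  have : (GW.haarTriple μ).μ.IsAddHaarMeasure := ‹μ.IsAddHaarMeasure›
  have h := GW.irreducibleOver_real (T := GW.haarTriple μ) (fun _ _ => rfl) b
  exact ⟨h.of_real, h⟩
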